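/- Let $\mathcal{P}_2(z)=\sum_{n\ge 0}|\mathcal{S}_n\cap Av(4123,1243)|\,z^n$ be the generating function of the class of permutations that avoid both patterns $4123$ and $1243$ (the empty permutation included). Then $$\mathcal{P}_2(z)=\frac{2-8z+2z^2+17z^3-15z^4+4z^5-(2-10z+16z^2-9z^3+2z^4)\sqrt{1-6z+5z^2}}{2z(2-z)^2(1-2z)(1-3z+z^2)},$$ where $\sqrt{1-6z+5z^2}$ is the formal power series with constant term $1$ whose square is $1-6z+5z^2$. Moreover $\mathcal{P}_2(z)=\mathcal{J}(z)+\mathcal{K}(z)$, where $\mathcal{J}(z)$ is the generating function of the permutations that avoid $4123$, $1243$ and $1423$, $\mathcal{K}(z)$ is the generating function of the permutations that avoid $4123$ and $1243$ but contain $1423$, and $$\mathcal{J}(z)=\frac{1+z-\sqrt{1-6z+5z^2}}{2(2z-z^2)},\qquad \mathcal{K}(z)=\frac{(1-z)\left(1-5z+4z^2-2z^3-(1-2z)\sqrt{1-6z+5z^2}\right)}{2(1-2z)(1-3z+z^2)(2-z)^2}.$$ -/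

import Mathlib

open PowerSeries LaurentSeries

/-- `Contains σ π`: the permutation `σ` of `{0, …, n-1}` contains the pattern written in one-line
notation as `π 0, π 1, …, π (k-1)`, that is, `σ` has a subsequence of length `k` (at the
positions `f 0 < f 1 < …`) whose entries are in the same relative order as those of `π`. -/
def Contains {n k : ℕ} (σ : Equiv.Perm (Fin n)) (π : Fin k → ℕ) : Prop :=
  ∃ f : Fin k → Fin n, StrictMono f ∧ ∀ i j : Fin k, σ (f i) < σ (f j) ↔ π i < π j

/-- `σ` avoids the pattern `π`. -/
def Avoids {n k : ℕ} (σ : Equiv.Perm (Fin n)) (π : Fin k → ℕ) : Prop :=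
  ¬ Contains σ π

/-- The ordinary generating function `∑ₙ |C ∩ 𝒮ₙ| zⁿ` (with `n = 0` included) of a set `C` of
finite permutations, given by its parts `C n` of length `n`. -/
noncomputable def genFun (C : (n : ℕ) → Set (Equiv.Perm (Fin n))) : ℚ⟦X⟧ :=
  PowerSeries.mk fun n => ((C n).ncard : ℚ)

/-- The class `Av(4123, 1243)`. -/
def classAv : (n : ℕ) → Set (Equiv.Perm (Fin n)) :=
  fun _ => {σ | Avoids σ ![4, 1, 2, 3] ∧ Avoids σ ![1, 2, 4, 3]}

/-- The subclass `Av(4123, 1243, 1423)`. -/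
def subclassAv : (n : ℕ) → Set (Equiv.Perm (Fin n)) :=
  fun n => {σ | σ ∈ classAv n ∧ Avoids σ ![1, 4, 2, 3]}

/-- The permutations in `Av(4123, 1243)` that contain `1423`. -/
def containing1423 : (n : ℕ) → Set (Equiv.Perm (Fin n)) :=
  fun n => {σ | σ ∈ classAv n ∧ Contains σ ![1, 4, 2, 3]}

/-!
Both classes are generated by appending a last entry: a permutation `σ` of `{0, …, n-1}` has the
sites `0, …, n`, and appending at the site `v` makes `v` the last entry and raises the entries that
are at least `v`. In `4123`, `1243` and `1423` the last entry is the second largest, so whether a site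
`v` is allowed depends only on the increasing pairs of entries below `v` and on where the entries
above `v` stand relative to them (`append_mem_classAv`, `append_mem_subclassAv`). The top
site `n` is allowed, and so are the sites `0, …, k` below which the entries are decreasing; if `σ` is
not decreasing, then `k < n` is called its level. In `Av(4123, 1243, 1423)` nothing else is allowed, and the
level determines the levels of the children. In `Av(4123, 1243)` there may be further allowed sites,
the upper sites: those at which all entries above the site stand between the terms of every
increasing pair below it.

The children of a permutation that is not decreasing are governed by its level `k`, the number `t` of
its upper sites and one of three modes. It may begin with its `k` smallest entries in decreasing
order (`Prefixed`); otherwise the entries above an upper site all stand to the right of `0` either for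
every upper site (`Flagged`) or for none (`Unflagged`). The states of the children follow:
appending at an upper site or at the top destroys all upper sites, appending `0` keeps them but
makes them unflagged, and appending `v` with `1 ≤ v ≤ k` keeps exactly the flagged ones, lowers the
level to `v`, and creates a new upper site in the prefixed mode.

The generating function of the descendants of a permutation thus depends on its state only, and these
series are determined by a linear system. Its solution is affine in `t`, and in `k` it is a
combination of `r ^ k` and `(1 - X)⁻¹ ^ k`, where `r` is the power series with
`X r² = (1 - X)(r - 1)`; the square root in the statement is `1 - X - 2 X r`. The descendants of the
empty permutation are the whole class. The equations are checked for the closed forms in the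
namespace `TreeSeries`, and the induction lemmas `class_descendants_dec` and
`subclass_descendants_dec` identify the coefficients.
-/

/-! ### Appending a last entry -/

/-- The permutation of `{0, …, n}` obtained from `σ` by appending a last entry `v`, the entries of
`σ` that are at least `v` being raised by one. -/
def appendValue {n : ℕ} (σ : Equiv.Perm (Fin n)) (v : Fin (n + 1)) : Equiv.Perm (Fin (n + 1)) :=
  (finSuccEquiv' (Fin.last n)).trans ((Equiv.optionCongr σ).trans (finSuccEquiv' v).symm)

section Append

variable {n : ℕ} (σ : Equiv.Perm (Fin n)) (v : Fin (n + 1))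

@[simp]
lemma appendValue_last : appendValue σ v (Fin.last n) = v := by
  simp [appendValue]

@[simp]
lemma appendValue_castSucc (i : Fin n) :
    appendValue σ v i.castSucc = v.succAbove (σ i) := by
  simp [appendValue, finSuccEquiv'_last_apply_castSucc]

lemma val_succAbove_eq_ite (x : Fin n) :
    (v.succAbove x : ℕ) = if (x : ℕ) < v then (x : ℕ) else x + 1 := by
  unfold Fin.succAbove
  simp only [Fin.lt_def, Fin.val_castSucc]
  split_ifs <;> simp

@[simp]
lemma val_succAbove_lt_val_succAbove (x y : Fin n) :
    (v.succAbove x : ℕ) < v.succAbove y ↔ (x : ℕ) < y := by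
  simp only [val_succAbove_eq_ite]; split_ifs <;> omega

@[simp]
lemma val_succAbove_lt (x : Fin n) : (v.succAbove x : ℕ) < v ↔ (x : ℕ) < v := by
  simp only [val_succAbove_eq_ite]; split_ifs <;> omega

@[simp]
lemma lt_val_succAbove (x : Fin n) : (v : ℕ) < v.succAbove x ↔ (v : ℕ) ≤ x := by
  simp only [val_succAbove_eq_ite]; split_ifs <;> omega

lemma appendValue_bijective :
    Function.Bijective
      (fun p : Equiv.Perm (Fin n) × Fin (n + 1) => appendValue p.1 p.2) := by
  rw [Fintype.bijective_iff_injective_and_card]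
  refine ⟨?_, by simp [Fintype.card_perm, Nat.factorial_succ, mul_comm]⟩
  rintro ⟨σ, v⟩ ⟨τ, w⟩ h
  have hv : v = w := by
    have := congrArg (fun ρ => ρ (Fin.last n)) h
    simpa using this
  subst hv
  have hσ : σ = τ := by
    ext i
    have := congrArg (fun ρ => ρ i.castSucc) h
    simp only [appendValue_castSucc, Fin.succAbove_right_inj] at this
    rw [this]
  rw [hσ]

lemma sum_perm_succ (f : Equiv.Perm (Fin (n + 1)) → ℕ) :
    ∑ τ, f τ = ∑ σ : Equiv.Perm (Fin n), ∑ v, f (appendValue σ v) := by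
  rw [← Fintype.sum_prod_type']
  exact ((appendValue_bijective (n := n)).sum_comp f).symm

end Append

/-! ### Active sites -/

/-- The entries of `σ` below `h` appear in decreasing order, stated contrapositively: an increasing
pair of entries has its larger term at least `h`. -/
def DecBelow {n : ℕ} (σ : Equiv.Perm (Fin n)) (h : ℕ) : Prop :=
  ∀ a b, a < b → (σ a : ℕ) < σ b → h ≤ σ b

/-- Every entry of `σ` that is at least `h` stands between the two terms of every increasing pair of
entries below `h`. By `append_mem_classAv`, these are the sites `h` at which a last entry can be
appended without creating `4123` or `1243`. -/
def ActiveSite {n : ℕ} (σ : Equiv.Perm (Fin n)) (h : ℕ) : Prop :=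
  ∀ a b x, a < b → (σ a : ℕ) < σ b → (σ b : ℕ) < h → h ≤ σ x → a < x ∧ x < b

/-- The least entry `0` of `σ` precedes all entries that are at least `h`. -/
def ZeroBefore {n : ℕ} (σ : Equiv.Perm (Fin n)) (h : ℕ) : Prop :=
  ∀ a x, (σ a : ℕ) = 0 → h ≤ σ x → a < x

section Patterns

variable {n : ℕ}

lemma contains_iff (σ : Equiv.Perm (Fin n)) (π : Fin 4 → ℕ) :
    Contains σ π ↔ ∃ p q r s : Fin n, p < q ∧ q < r ∧ r < s ∧
      ∀ i j : Fin 4, (σ (![p, q, r, s] i) : ℕ) < σ (![p, q, r, s] j) ↔ π i < π j := by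
  constructor
  · rintro ⟨f, hf, h⟩
    refine ⟨f 0, f 1, f 2, f 3, hf (by decide), hf (by decide), hf (by decide), ?_⟩
    have : ![f 0, f 1, f 2, f 3] = f := by
      ext i; fin_cases i <;> rfl
    rw [this]
    exact h
  · rintro ⟨p, q, r, s, hpq, hqr, hrs, h⟩
    refine ⟨![p, q, r, s], ?_, h⟩
    rw [Fin.strictMono_iff_lt_succ]
    intro i
    fin_cases i
    · exact hpq
    · exact hqr
    · exact hrs

lemma contains_4123_iff (σ : Equiv.Perm (Fin n)) :
    Contains σ ![4, 1, 2, 3] ↔ ∃ x a b c : Fin n, x < a ∧ a < b ∧ b < c ∧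
      (σ a : ℕ) < σ b ∧ (σ b : ℕ) < σ c ∧ (σ c : ℕ) < σ x := by
  rw [contains_iff]
  refine exists_congr fun p => exists_congr fun q => exists_congr fun r => exists_congr fun s =>
    and_congr_right fun _ => and_congr_right fun _ => and_congr_right fun _ => ?_
  simp only [Fin.forall_fin_succ]
  simp
  omega

lemma contains_1243_iff (σ : Equiv.Perm (Fin n)) :
    Contains σ ![1, 2, 4, 3] ↔ ∃ a b x c : Fin n, a < b ∧ b < x ∧ x < c ∧
      (σ a : ℕ) < σ b ∧ (σ b : ℕ) < σ c ∧ (σ c : ℕ) < σ x := by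
  rw [contains_iff]
  refine exists_congr fun p => exists_congr fun q => exists_congr fun r => exists_congr fun s =>
    and_congr_right fun _ => and_congr_right fun _ => and_congr_right fun _ => ?_
  simp only [Fin.forall_fin_succ]
  simp
  omega

lemma contains_1423_iff (σ : Equiv.Perm (Fin n)) :
    Contains σ ![1, 4, 2, 3] ↔ ∃ a x b c : Fin n, a < x ∧ x < b ∧ b < c ∧
      (σ a : ℕ) < σ b ∧ (σ b : ℕ) < σ c ∧ (σ c : ℕ) < σ x := by
  rw [contains_iff]
  refine exists_congr fun p => exists_congr fun q => exists_congr fun r => exists_congr fun s =>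
    and_congr_right fun _ => and_congr_right fun _ => and_congr_right fun _ => ?_
  simp only [Fin.forall_fin_succ]
  simp
  omega

@[simp]
lemma not_last_lt_castSucc (i : Fin n) : ¬ Fin.last n < i.castSucc :=
  (Fin.le_last _).not_gt

lemma contains_append_4123 (σ : Equiv.Perm (Fin n)) (v : Fin (n + 1)) :
    Contains (appendValue σ v) ![4, 1, 2, 3] ↔ Contains σ ![4, 1, 2, 3] ∨
      ∃ x a b : Fin n, x < a ∧ a < b ∧
        (σ a : ℕ) < σ b ∧ (σ b : ℕ) < v ∧ (v : ℕ) ≤ σ x := by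
  simp [-Fin.val_fin_lt, contains_4123_iff, Fin.exists_fin_succ', and_or_left, exists_or]

lemma contains_append_1243 (σ : Equiv.Perm (Fin n)) (v : Fin (n + 1)) :
    Contains (appendValue σ v) ![1, 2, 4, 3] ↔ Contains σ ![1, 2, 4, 3] ∨
      ∃ a b x : Fin n, a < b ∧ b < x ∧
        (σ a : ℕ) < σ b ∧ (σ b : ℕ) < v ∧ (v : ℕ) ≤ σ x := by
  simp [-Fin.val_fin_lt, contains_1243_iff, Fin.exists_fin_succ', and_or_left, exists_or]

lemma contains_append_1423 (σ : Equiv.Perm (Fin n)) (v : Fin (n + 1)) :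
    Contains (appendValue σ v) ![1, 4, 2, 3] ↔ Contains σ ![1, 4, 2, 3] ∨
      ∃ a x b : Fin n, a < x ∧ x < b ∧
        (σ a : ℕ) < σ b ∧ (σ b : ℕ) < v ∧ (v : ℕ) ≤ σ x := by
  simp [-Fin.val_fin_lt, contains_1423_iff, Fin.exists_fin_succ', and_or_left, exists_or]

/-- In both `4123` and `1243` the last entry is the second largest, so the new occurrences of these
patterns have the appended entry as their `3`. -/
lemma append_mem_classAv (σ : Equiv.Perm (Fin n)) (v : Fin (n + 1)) :
    appendValue σ v ∈ classAv (n + 1) ↔ σ ∈ classAv n ∧ ActiveSite σ v := by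
  simp only [classAv, Avoids, Set.mem_ofPred_eq, contains_append_4123, contains_append_1243,
    ActiveSite]
  constructor
  · rintro ⟨h₁, h₂⟩
    push Not at h₁ h₂
    refine ⟨⟨h₁.1, h₂.1⟩, fun a b x hab hσ hb hx => ⟨?_, ?_⟩⟩
    · by_contra hax
      rcases eq_or_lt_of_le (not_lt.1 hax) with rfl | hlt
      · omega
      · exact absurd hx (not_le.2 (h₁.2 x a b hlt hab hσ hb))
    · by_contra hbx
      rcases eq_or_lt_of_le (not_lt.1 hbx) with rfl | hlt
      · omega
      · exact absurd hx (not_le.2 (h₂.2 a b x hab hlt hσ hb))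
  · rintro ⟨⟨h₁, h₂⟩, h⟩
    refine ⟨?_, ?_⟩
    · rintro (h' | ⟨x, a, b, hxa, hab, hσ, hb, hx⟩)
      · exact h₁ h'
      · exact lt_asymm hxa (h a b x hab hσ hb hx).1
    · rintro (h' | ⟨a, b, x, hab, hbx, hσ, hb, hx⟩)
      · exact h₂ h'
      · exact lt_asymm hbx (h a b x hab hσ hb hx).2

lemma exists_val_eq (σ : Equiv.Perm (Fin n)) {h : ℕ} (hn : h < n) : ∃ x, (σ x : ℕ) = h :=
  ⟨σ.symm ⟨h, hn⟩, by simp⟩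

lemma eq_of_val_eq (σ : Equiv.Perm (Fin n)) {a b : Fin n} (h : (σ a : ℕ) = σ b) : a = b :=
  σ.injective (Fin.ext h)

/-- Avoiding `1423` as well leaves an entry above the site no place relative to an increasing pair
below it, so there is no such pair or no such entry. -/
lemma append_mem_subclassAv (σ : Equiv.Perm (Fin n)) (v : Fin (n + 1)) :
    appendValue σ v ∈ subclassAv (n + 1) ↔
      σ ∈ subclassAv n ∧ (DecBelow σ v ∨ (v : ℕ) = n) := by
  simp only [subclassAv, Set.mem_ofPred_eq, append_mem_classAv, Avoids, contains_append_1423]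
  constructor
  · rintro ⟨⟨hσ, hv⟩, h⟩
    push Not at h
    refine ⟨⟨hσ, h.1⟩, ?_⟩
    by_contra! hcon
    obtain ⟨hdec, hvn⟩ := hcon
    simp only [DecBelow, not_forall, not_le] at hdec
    obtain ⟨a, b, hab, hlt, hb⟩ := hdec
    obtain ⟨x, hx⟩ := exists_val_eq σ (h := v) (by omega)
    have hab' := hv a b x hab hlt hb hx.ge
    exact absurd hx (h.2 a x b hab'.1 hab'.2 hlt hb).ne
  · rintro ⟨⟨hσ, hc⟩, hv⟩
    have key : ∀ a b x : Fin n, a < b → (σ a : ℕ) < σ b → (σ b : ℕ) < v → (v : ℕ) ≤ σ x →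
        False := by
      intro a b x hab hlt hb hx
      rcases hv with hv | hv
      · exact absurd hb (not_lt.2 (hv a b hab hlt))
      · exact absurd (σ x).2 (by omega)
    refine ⟨⟨hσ, fun a b x hab hlt hb hx => (key a b x hab hlt hb hx).elim⟩, ?_⟩
    rintro (h' | ⟨a, x, b, hax, hxb, hlt, hb, hx⟩)
    · exact hc h'
    · exact key a b x (hax.trans hxb) hlt hb hx

end Patterns

section Sites

variable {n : ℕ} {σ : Equiv.Perm (Fin n)} {h k : ℕ}

lemma DecBelow.mono (hd : DecBelow σ h) (hk : k ≤ h) : DecBelow σ k :=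
  fun a b hab hlt => hk.trans (hd a b hab hlt)

lemma DecBelow.activeSite (hd : DecBelow σ h) : ActiveSite σ h :=
  fun a b _ hab hlt hb _ => absurd hb (not_lt.2 (hd a b hab hlt))

lemma not_decBelow_iff :
    ¬ DecBelow σ h ↔ ∃ a b, a < b ∧ (σ a : ℕ) < σ b ∧ (σ b : ℕ) < h := by
  simp [DecBelow]

lemma activeSite_self (σ : Equiv.Perm (Fin n)) : ActiveSite σ n :=
  fun _ _ x _ _ _ hx => absurd (σ x).2 (not_lt.2 hx)

variable {v : Fin (n + 1)}

lemma le_val_succAbove_iff (hv : h ≤ v) (x : Fin n) :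
    h ≤ (v.succAbove x : ℕ) ↔ h ≤ (x : ℕ) := by
  rw [val_succAbove_eq_ite]; split_ifs <;> omega

lemma succ_le_val_succAbove_iff (hv : (v : ℕ) ≤ h) (x : Fin n) :
    h + 1 ≤ (v.succAbove x : ℕ) ↔ h ≤ (x : ℕ) := by
  rw [val_succAbove_eq_ite]; split_ifs <;> omega

lemma val_succAbove_lt_iff_of_le (hv : h ≤ v) (x : Fin n) :
    (v.succAbove x : ℕ) < h ↔ (x : ℕ) < h := by
  simpa using not_congr (le_val_succAbove_iff hv x)

lemma val_succAbove_lt_succ_iff (hv : (v : ℕ) ≤ h) (x : Fin n) :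
    (v.succAbove x : ℕ) < h + 1 ↔ (x : ℕ) < h := by
  simpa using not_congr (succ_le_val_succAbove_iff hv x)

lemma decBelow_append (hv : h ≤ v) : DecBelow (appendValue σ v) h ↔ DecBelow σ h := by
  simp only [DecBelow, Fin.forall_fin_succ']
  simp [-Fin.val_fin_lt, le_val_succAbove_iff hv, hv]

lemma decBelow_append_zero : DecBelow (appendValue σ 0) (h + 1) ↔ DecBelow σ h := by
  simp only [DecBelow, Fin.forall_fin_succ']
  simp [-Fin.val_fin_lt, -Fin.succAbove_zero]

lemma not_decBelow_append_succ (h0 : 0 < (v : ℕ)) (hv : (v : ℕ) ≤ h) :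
    ¬ DecBelow (appendValue σ v) (h + 1) := by
  obtain ⟨x, hx⟩ := exists_val_eq σ (h := 0) (by omega)
  refine not_decBelow_iff.2 ⟨x.castSucc, Fin.last n, Fin.castSucc_lt_last x, ?_, ?_⟩
  · simp [-Fin.val_fin_lt, hx, h0]
  · simp; omega

/-- The appended entry follows all increasing pairs, so a site at or below it stays active only if
there are no increasing pairs below that site. -/
lemma activeSite_append (hv : h ≤ v) : ActiveSite (appendValue σ v) h ↔ DecBelow σ h := by
  constructor
  · intro ha
    by_contra hd
    obtain ⟨a, b, hab, hlt, hb⟩ := not_decBelow_iff.1 hd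
    have := (ha a.castSucc b.castSucc (Fin.last n) (by simpa) (by simpa)
      (by simpa [val_succAbove_lt_iff_of_le hv] using hb) (by simpa)).2
    simp at this
  · exact fun hd => ((decBelow_append hv).2 hd).activeSite

/-- Above the appended entry `v`, the new increasing pairs are those formed by an entry below `v` and
`v` itself. -/
lemma activeSite_append_succ (hv : (v : ℕ) ≤ h) :
    ActiveSite (appendValue σ v) (h + 1) ↔ ActiveSite σ h ∧
      ∀ a x, (σ a : ℕ) < v → h ≤ σ x → a < x := by
  have hh : (v : ℕ) < h + 1 := by omega
  have hh' : ¬ h + 1 ≤ (v : ℕ) := by omega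
  simp only [ActiveSite, Fin.forall_fin_succ', not_last_lt_castSucc, Fin.castSucc_lt_castSucc_iff,
    Fin.castSucc_lt_last, appendValue_castSucc, appendValue_last, succ_le_val_succAbove_iff hv,
    val_succAbove_lt_val_succAbove, val_succAbove_lt, val_succAbove_lt_succ_iff hv, hh, hh',
    lt_irrefl, false_imp_iff, true_imp_iff, imp_true_iff, and_true, forall_and]
  exact and_right_comm

lemma val_succAbove_eq_zero_iff (h0 : 0 < (v : ℕ)) (x : Fin n) :
    (v.succAbove x : ℕ) = 0 ↔ (x : ℕ) = 0 := by
  rw [val_succAbove_eq_ite]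
  split_ifs
  · rfl
  · exact iff_of_false not_false (by omega)

lemma zeroBefore_append (h0 : 0 < (v : ℕ)) (hv : h ≤ v) :
    ZeroBefore (appendValue σ v) h ↔ ZeroBefore σ h := by
  have h1 := val_succAbove_eq_zero_iff h0
  simp [ZeroBefore, Fin.forall_fin_succ', -Fin.val_eq_zero_iff, le_val_succAbove_iff hv, h1, h0.ne']

lemma zeroBefore_append_succ (h0 : 0 < (v : ℕ)) (hv : v ≤ h) :
    ZeroBefore (appendValue σ v) (h + 1) ↔ ZeroBefore σ h := by
  have h1 := val_succAbove_eq_zero_iff h0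
  simp only [ZeroBefore, Fin.forall_fin_succ', appendValue_castSucc, appendValue_last, h1,
    succ_le_val_succAbove_iff hv, h0.ne', Fin.castSucc_lt_castSucc_iff, false_imp_iff,
    imp_true_iff, and_true, Fin.castSucc_lt_last]

lemma not_zeroBefore_append_zero (hn : h < n) :
    ¬ ZeroBefore (appendValue σ 0) (h + 1) := by
  obtain ⟨x, hx⟩ := exists_val_eq σ hn
  intro hz
  exact not_last_lt_castSucc x (hz (Fin.last n) x.castSucc (by simp) (by simp [hx]))

end Sites

/-! ### Levels and upper sites -/

section States

open Classical in
/-- The active sites `h < n` of `σ` below which the entries of `σ` are not in decreasing order. -/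
noncomputable def upperSites {n : ℕ} (σ : Equiv.Perm (Fin n)) : Finset ℕ :=
  (Finset.range n).filter fun h => ActiveSite σ h ∧ ¬ DecBelow σ h

variable {n : ℕ} {σ : Equiv.Perm (Fin n)} {h k : ℕ} {v : Fin (n + 1)}

lemma mem_upperSites : h ∈ upperSites σ ↔ h < n ∧ ActiveSite σ h ∧ ¬ DecBelow σ h := by
  simp [upperSites]

/-- The number of the smallest entries of `σ` that are in decreasing order is exactly `k`, and `σ`
is not decreasing. -/
def DecLevel (σ : Equiv.Perm (Fin n)) (k : ℕ) : Prop :=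
  DecBelow σ k ∧ ¬ DecBelow σ (k + 1)

lemma DecLevel.pos_and_lt (hk : DecLevel σ k) : 0 < k ∧ k < n := by
  obtain ⟨a, b, hab, hlt, hb⟩ := not_decBelow_iff.1 hk.2
  have := hk.1 a b hab hlt
  have := (σ b).2
  omega

lemma DecLevel.decBelow_iff (hk : DecLevel σ k) : DecBelow σ h ↔ h ≤ k :=
  ⟨fun hd => not_lt.1 fun hlt => hk.2 (hd.mono hlt), hk.1.mono⟩

lemma DecLevel.lt_of_mem (hk : DecLevel σ k) (hh : h ∈ upperSites σ) : k < h := by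
  have := (mem_upperSites.1 hh).2.2
  rwa [hk.decBelow_iff, not_le] at this

/-- If the entries below `v` are decreasing, then `0` is the last of them, so that the condition of
`activeSite_append_succ` is a condition on `0` only. -/
lemma zeroBefore_iff_of_decBelow (hd : DecBelow σ v) (h0 : 0 < (v : ℕ)) :
    ZeroBefore σ h ↔ ∀ a x, (σ a : ℕ) < v → h ≤ σ x → a < x := by
  constructor
  · intro hz a x ha hx
    obtain ⟨c, hc⟩ := exists_val_eq σ (h := 0) (by omega)
    have hcx := hz c x hc hx
    by_contra hax
    have hca : c < a := lt_of_lt_of_le hcx (not_lt.1 hax)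
    have hne : (σ a : ℕ) ≠ 0 := fun h => hca.ne (eq_of_val_eq σ (hc.trans h.symm))
    have := hd c a hca (by omega)
    omega
  · exact fun hz a x ha hx => hz a x (by omega) hx

/-- If the `k` smallest entries are decreasing, the entry `h < k` itself precedes `0`. -/
lemma not_zeroBefore_of_decBelow (hd : DecBelow σ k) (h0 : 0 < h) (hk : h < k) (hn : h < n) :
    ¬ ZeroBefore σ h := by
  intro hz
  obtain ⟨c, hc⟩ := exists_val_eq σ (h := 0) (by omega)
  obtain ⟨x, hx⟩ := exists_val_eq σ hn
  have := hd c x (hz c x hc hx.ge) (by omega)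
  omega

lemma ZeroBefore.mono (hz : ZeroBefore σ k) (hk : k ≤ h) : ZeroBefore σ h :=
  fun a x ha hx => hz a x ha (hk.trans hx)

lemma decLevel_append_zero (hk : DecLevel σ k) : DecLevel (appendValue σ 0) (k + 1) :=
  ⟨decBelow_append_zero.2 hk.1, fun h => hk.2 (decBelow_append_zero.1 h)⟩

lemma decLevel_append_of_decBelow (hd : DecBelow σ v) (h0 : 0 < (v : ℕ)) :
    DecLevel (appendValue σ v) v :=
  ⟨(decBelow_append le_rfl).2 hd, not_decBelow_append_succ h0 le_rfl⟩

lemma decLevel_append_of_lt (hk : DecLevel σ k) (hv : k < v) : DecLevel (appendValue σ v) k :=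
  ⟨(decBelow_append hv.le).2 hk.1, fun h => hk.2 ((decBelow_append hv).1 h)⟩

lemma upperSites_append_zero :
    upperSites (appendValue σ 0) = (upperSites σ).map (addRightEmbedding 1) := by
  ext h
  rcases h with _ | h
  · simp [mem_upperSites, DecBelow]
  · simp [mem_upperSites, decBelow_append_zero, activeSite_append_succ (v := 0) (Nat.zero_le h)]

/-- Appending a value at a site below which the entries are not decreasing leaves no active site
strictly between the decreasing smallest entries and the top. -/
lemma upperSites_append_of_not_decBelow (hd : ¬ DecBelow σ v) (ha : ActiveSite σ v) :
    upperSites (appendValue σ v) = ∅ := by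
  refine Finset.eq_empty_of_forall_notMem fun h hh => ?_
  obtain ⟨hn, hact, hdec⟩ := mem_upperSites.1 hh
  rcases le_or_gt h v with hv | hv
  · exact hdec ((decBelow_append hv).2 ((activeSite_append hv).1 hact))
  · obtain ⟨g, rfl⟩ : ∃ g, h = g + 1 := ⟨h - 1, by omega⟩
    have hg := ((activeSite_append_succ (by omega)).1 hact).2
    obtain ⟨a, b, hab, hlt, hb⟩ := not_decBelow_iff.1 hd
    obtain ⟨x, hx⟩ := exists_val_eq σ (h := g) (by omega)
    exact lt_asymm (ha a b x hab hlt hb (by omega)).2 (hg b x hb hx.ge)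

lemma mem_upperSites_append_of_decBelow (hd : DecBelow σ v) (h0 : 0 < (v : ℕ)) :
    h ∈ upperSites (appendValue σ v) ↔
      ∃ g, g + 1 = h ∧ v ≤ g ∧ g < n ∧ ActiveSite σ g ∧ ZeroBefore σ g := by
  rw [mem_upperSites]
  rcases le_or_gt h v with hv | hv
  · simp only [decBelow_append hv, hd.mono hv, not_true_eq_false, and_false, false_iff]
    rintro ⟨g, rfl, hg, -⟩
    omega
  · obtain ⟨g, rfl⟩ : ∃ g, h = g + 1 := ⟨h - 1, by omega⟩
    have hg : (v : ℕ) ≤ g := by omega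
    rw [activeSite_append_succ hg, ← zeroBefore_iff_of_decBelow hd h0]
    simp [not_decBelow_append_succ h0 hg, hg]

end States

/-! ### Counting by descendants -/

open Classical in
/-- The number of permutations obtained from `σ` by appending `m` further entries, each at a site
allowed by `ok`. -/
noncomputable def descendants (ok : ∀ {n : ℕ}, Equiv.Perm (Fin n) → ℕ → Prop) :
    ℕ → ∀ {n : ℕ}, Equiv.Perm (Fin n) → ℕ
  | 0, _, _ => 1
  | m + 1, n, σ => ∑ v : Fin (n + 1), if ok σ v then descendants ok m (appendValue σ v) else 0

section Descendants

variable {ok : ∀ {n : ℕ}, Equiv.Perm (Fin n) → ℕ → Prop}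

open Classical in
/-- A class of permutations generated by appending last entries at allowed sites is counted by the
descendants of the empty permutation. -/
lemma coeff_genFun {C : (n : ℕ) → Set (Equiv.Perm (Fin n))}
    (h0 : (1 : Equiv.Perm (Fin 0)) ∈ C 0)
    (hC : ∀ (n : ℕ) (σ : Equiv.Perm (Fin n)) (v : Fin (n + 1)),
      appendValue σ v ∈ C (n + 1) ↔ σ ∈ C n ∧ ok σ v) (m : ℕ) :
    coeff m (genFun C) = descendants ok m (1 : Equiv.Perm (Fin 0)) := by
  -- Each element of `C (n + 1)` arises from exactly one element of `C n`.
  have key : ∀ m n, (∑ σ : Equiv.Perm (Fin n), if σ ∈ C n then descendants ok m σ else 0) =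
      (C (n + m)).ncard := by
    intro m
    induction m with
    | zero =>
      intro n
      simp only [descendants, Set.ncard_eq_toFinset_card', Finset.sum_boole,
        Nat.cast_id]
      congr 1
      ext σ
      simp
    | succ m ih =>
      intro n
      rw [show n + (m + 1) = n + 1 + m by omega, ← ih, sum_perm_succ]
      refine Finset.sum_congr rfl fun σ _ => ?_
      split_ifs with hσ
      · simp [descendants, hC, hσ]
      · simp [hC, hσ]
  have := key m 0
  rw [Fintype.sum_unique] at this
  rw [genFun, coeff_mk, Nat.cast_inj]
  rw [zero_add] at this
  rw [← this, Subsingleton.elim default (1 : Equiv.Perm (Fin 0)), if_pos h0]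

open Classical in
/-- The sum over the allowed sites: the site `0`, the sites `1, …, k`, and the sites in `E`, which
all contribute the same. -/
lemma sum_sites {n k : ℕ} (P : ℕ → Prop) (E : Finset ℕ) (hP : ∀ v ≤ n, P v ↔ v ≤ k ∨ v ∈ E)
    (hE : ∀ v ∈ E, k < v ∧ v ≤ n) (hk : k ≤ n) (f : Fin (n + 1) → ℚ) (a c : ℚ) (b : ℕ → ℚ)
    (ha : f 0 = a) (hb : ∀ v : Fin (n + 1), 0 < (v : ℕ) → (v : ℕ) ≤ k → f v = b v)
    (hc : ∀ v : Fin (n + 1), (v : ℕ) ∈ E → f v = c) :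
    (∑ v : Fin (n + 1), if P v then f v else 0) =
      a + ∑ i ∈ Finset.Icc 1 k, b i + E.card * c := by
  have h1 : ∀ v : Fin (n + 1), (if P v then f v else 0) =
      (fun i : ℕ => (if i = 0 then a else 0) + (if i ∈ Finset.Icc 1 k then b i else 0) +
        (if i ∈ E then c else 0)) v := by
    intro v
    have hv := hP v (by omega)
    simp only [hv, Finset.mem_Icc]
    rcases Nat.eq_zero_or_pos (v : ℕ) with h | h
    · have hvE : (v : ℕ) ∉ E := fun h' => by have := hE _ h'; omega
      have : v = 0 := Fin.ext h
      subst this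
      rw [if_neg hvE]
      simp [ha]
    · by_cases hvk : (v : ℕ) ≤ k
      · have hvE : (v : ℕ) ∉ E := fun h' => by have := hE _ h'; omega
        simp [hvk, hvE, h.ne', hb v h hvk]
      · simp only [hvk, h.ne', false_or, and_false, if_false, zero_add]
        split_ifs with hvE
        · exact hc v hvE
        · rfl
  rw [Finset.sum_congr rfl fun v _ => h1 v,
    Fin.sum_univ_eq_sum_range (fun i : ℕ => (if i = 0 then a else 0) +
      (if i ∈ Finset.Icc 1 k then b i else 0) + (if i ∈ E then c else 0)),
    Finset.sum_add_distrib, Finset.sum_add_distrib, Finset.sum_ite_mem, Finset.sum_ite_mem]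
  have h2 : Finset.range (n + 1) ∩ Finset.Icc 1 k = Finset.Icc 1 k :=
    Finset.inter_eq_right.2 fun i hi => by
      have := Finset.mem_Icc.1 hi; exact Finset.mem_range.2 (by omega)
  have h3 : Finset.range (n + 1) ∩ E = E :=
    Finset.inter_eq_right.2 fun i hi => Finset.mem_range.2 (by have := hE i hi; omega)
  rw [h2, h3]
  simp

lemma cast_descendants_succ (m : ℕ) {n : ℕ} (σ : Equiv.Perm (Fin n)) [∀ v, Decidable (ok σ v)] :
    (descendants ok (m + 1) σ : ℚ) =
      ∑ v : Fin (n + 1), if ok σ v then (descendants ok m (appendValue σ v) : ℚ) else 0 := by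
  simp only [descendants, Nat.cast_sum, Nat.cast_ite, Nat.cast_zero]

end Descendants

lemma coeff_succ_one_add_X_mul (f : ℚ⟦X⟧) (m : ℕ) : coeff (m + 1) (1 + X * f) = coeff m f := by
  rw [map_add, coeff_succ_X_mul, coeff_one, if_neg m.succ_ne_zero, zero_add]

lemma coeff_zero_one_add_X_mul (f : ℚ⟦X⟧) : coeff 0 (1 + X * f) = 1 := by simp

/-! ### The generating tree of `Av(4123, 1243, 1423)` -/

section Subclass

/-- The sites at which a last entry can be appended within `Av(4123, 1243, 1423)`. -/
def SubclassSite {n : ℕ} (σ : Equiv.Perm (Fin n)) (h : ℕ) : Prop := DecBelow σ h ∨ h = n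

variable {N D : ℕ → ℚ⟦X⟧}

/-- The descendants in `Av(4123, 1243, 1423)` of a permutation of level `k` that is not decreasing:
appending `0` gives level `k + 1`, appending `v` with `1 ≤ v ≤ k` gives level `v`, and appending a
maximum keeps the level. -/
lemma subclass_descendants_level
    (hN : ∀ k, 0 < k → N k = 1 + X * (N (k + 1) + ∑ i ∈ Finset.Icc 1 k, N i + N k)) (m : ℕ) :
    ∀ {n : ℕ} (σ : Equiv.Perm (Fin n)) (k : ℕ), DecLevel σ k →
      (descendants SubclassSite m σ : ℚ) = coeff m (N k) := by
  classical
  induction m with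
  | zero =>
    intro n σ k hk
    rw [hN k hk.pos_and_lt.1, coeff_zero_one_add_X_mul]
    simp [descendants]
  | succ m ih =>
    intro n σ k hk
    obtain ⟨hk0, hkn⟩ := hk.pos_and_lt
    rw [cast_descendants_succ, hN k hk0, coeff_succ_one_add_X_mul,
      sum_sites (SubclassSite σ) {n} (k := k) (a := coeff m (N (k + 1)))
        (b := fun i => coeff m (N i)) (c := coeff m (N k))]
    · simp
    · intro v hv
      simp [SubclassSite, hk.decBelow_iff]
    · simpa using hkn
    · exact hkn.le
    · exact ih _ _ (decLevel_append_zero hk)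
    · exact fun v h0 hv => ih _ _ (decLevel_append_of_decBelow (hk.decBelow_iff.2 hv) h0)
    · intro v hv
      refine ih _ _ (decLevel_append_of_lt hk ?_)
      rw [Finset.mem_singleton] at hv
      omega

/-- For a decreasing permutation the top site is one of the sites `1 ≤ v ≤ n` rather than a further
one, so decreasing permutations satisfy an equation of their own. -/
lemma subclass_descendants_dec
    (hN : ∀ k, 0 < k → N k = 1 + X * (N (k + 1) + ∑ i ∈ Finset.Icc 1 k, N i + N k))
    (hD : ∀ k, D k = 1 + X * (D (k + 1) + ∑ i ∈ Finset.Icc 1 k, N i)) (m : ℕ) :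
    ∀ {n : ℕ} (σ : Equiv.Perm (Fin n)), DecBelow σ n →
      (descendants SubclassSite m σ : ℚ) = coeff m (D n) := by
  classical
  induction m with
  | zero =>
    intro n σ hd
    rw [hD n, coeff_zero_one_add_X_mul]
    simp [descendants]
  | succ m ih =>
    intro n σ hd
    rw [cast_descendants_succ, hD n, coeff_succ_one_add_X_mul,
      sum_sites (SubclassSite σ) ∅ (k := n) (a := coeff m (D (n + 1)))
        (b := fun i => coeff m (N i)) (c := 0)]
    · simp
    · intro v hv
      simp [SubclassSite, hd.mono hv, hv]
    · simp
    · exact le_rfl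
    · exact ih _ (decBelow_append_zero.2 hd)
    · exact fun v h0 hv =>
        subclass_descendants_level hN m _ _ (decLevel_append_of_decBelow (hd.mono hv) h0)
    · simp

end Subclass

/-! ### The generating tree of `Av(4123, 1243)` -/

section Class

variable {n k : ℕ} {σ : Equiv.Perm (Fin n)} {v : Fin (n + 1)}

lemma DecLevel.activeSite_iff (hk : DecLevel σ k) {h : ℕ} (hn : h ≤ n) :
    ActiveSite σ h ↔ h ≤ k ∨ h ∈ insert n (upperSites σ) := by
  rw [Finset.mem_insert, mem_upperSites, ← hk.decBelow_iff]
  constructor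
  · intro ha
    by_cases hd : DecBelow σ h
    · exact Or.inl hd
    · rcases hn.eq_or_lt with rfl | hlt
      · exact Or.inr (Or.inl rfl)
      · exact Or.inr (Or.inr ⟨hlt, ha, hd⟩)
  · rintro (hd | rfl | h)
    · exact hd.activeSite
    · exact activeSite_self σ
    · exact h.2.1

lemma DecLevel.mem_insert_upperSites (hk : DecLevel σ k) :
    ∀ v ∈ insert n (upperSites σ), k < v ∧ v ≤ n := by
  intro v hv
  rcases Finset.mem_insert.1 hv with rfl | hv
  · exact ⟨hk.pos_and_lt.2, le_rfl⟩
  · exact ⟨hk.lt_of_mem hv, (mem_upperSites.1 hv).1.le⟩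

lemma card_insert_upperSites : (insert n (upperSites σ)).card = (upperSites σ).card + 1 :=
  Finset.card_insert_of_notMem fun h => lt_irrefl n (mem_upperSites.1 h).1

lemma upperSites_append_of_mem (hk : DecLevel σ k) (hv : (v : ℕ) ∈ insert n (upperSites σ)) :
    upperSites (appendValue σ v) = ∅ := by
  have hlt := (hk.mem_insert_upperSites v hv).1
  refine upperSites_append_of_not_decBelow (fun hd => ?_)
    ((hk.activeSite_iff (by omega)).2 (Or.inr hv))
  exact absurd (hk.decBelow_iff.1 hd) (by omega)

lemma zeroBefore_append_of_mem (hk : DecLevel σ k) (hv : (v : ℕ) ∈ insert n (upperSites σ)) :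
    ZeroBefore (appendValue σ v) k ↔ ZeroBefore σ k := by
  have hlt := (hk.mem_insert_upperSites v hv).1
  exact zeroBefore_append (by omega) hlt.le

/-- A permutation of level `k` with `t` upper sites, none of which has all the entries above it to the
right of `0`; nor has the site `k`. -/
structure Unflagged (σ : Equiv.Perm (Fin n)) (k t : ℕ) : Prop where
  level : DecLevel σ k
  card : (upperSites σ).card = t
  not_sep : ∀ h ∈ upperSites σ, ¬ ZeroBefore σ h
  not_prefix : ¬ ZeroBefore σ k

/-- A permutation of level `k` with `t` upper sites, each of which has all the entries above it to the
right of `0`, while the site `k` has not. -/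
structure Flagged (σ : Equiv.Perm (Fin n)) (k t : ℕ) : Prop where
  level : DecLevel σ k
  card : (upperSites σ).card = t
  sep : ∀ h ∈ upperSites σ, ZeroBefore σ h
  not_prefix : ¬ ZeroBefore σ k

/-- A permutation of level `k` with `t` upper sites that begins with its `k` smallest entries in
decreasing order: these end with `0`, so it suffices that `0` precedes all other entries. -/
structure Prefixed (σ : Equiv.Perm (Fin n)) (k t : ℕ) : Prop where
  level : DecLevel σ k
  card : (upperSites σ).card = t
  pre : ZeroBefore σ k

lemma unflagged_append_zero (hk : DecLevel σ k) :
    Unflagged (appendValue σ 0) (k + 1) (upperSites σ).card where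
  level := decLevel_append_zero hk
  card := by rw [upperSites_append_zero, Finset.card_map]
  not_sep h hh := by
    rw [upperSites_append_zero, Finset.mem_map] at hh
    obtain ⟨g, hg, rfl⟩ := hh
    exact not_zeroBefore_append_zero (mem_upperSites.1 hg).1
  not_prefix := not_zeroBefore_append_zero hk.pos_and_lt.2

lemma unflagged_append_of_mem (hk : DecLevel σ k) (hp : ¬ ZeroBefore σ k)
    (hv : (v : ℕ) ∈ insert n (upperSites σ)) : Unflagged (appendValue σ v) k 0 where
  level := decLevel_append_of_lt hk (hk.mem_insert_upperSites v hv).1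
  card := by rw [upperSites_append_of_mem hk hv, Finset.card_empty]
  not_sep h hh := by simp [upperSites_append_of_mem hk hv] at hh
  not_prefix := by rwa [zeroBefore_append_of_mem hk hv]

lemma Prefixed.append_of_mem {t : ℕ} (hσ : Prefixed σ k t)
    (hv : (v : ℕ) ∈ insert n (upperSites σ)) : Prefixed (appendValue σ v) k 0 where
  level := decLevel_append_of_lt hσ.level (hσ.level.mem_insert_upperSites v hv).1
  card := by rw [upperSites_append_of_mem hσ.level hv, Finset.card_empty]
  pre := by rw [zeroBefore_append_of_mem hσ.level hv]; exact hσ.pre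

lemma zeroBefore_of_mem_upperSites_append (hd : DecBelow σ v) (h0 : 0 < (v : ℕ)) {h : ℕ}
    (hh : h ∈ upperSites (appendValue σ v)) : ZeroBefore (appendValue σ v) h := by
  obtain ⟨g, rfl, hg, -, -, hz⟩ := (mem_upperSites_append_of_decBelow hd h0).1 hh
  exact (zeroBefore_append_succ h0 hg).2 hz

/-- Without the decreasing prefix, only the flagged upper sites survive. -/
lemma upperSites_append_of_not_prefix (hk : DecLevel σ k) (hp : ¬ ZeroBefore σ k)
    (h0 : 0 < (v : ℕ)) (hv : (v : ℕ) ≤ k) {h : ℕ} :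
    h ∈ upperSites (appendValue σ v) ↔ ∃ g, g + 1 = h ∧ g ∈ upperSites σ ∧ ZeroBefore σ g := by
  rw [mem_upperSites_append_of_decBelow (hk.decBelow_iff.2 hv) h0]
  refine exists_congr fun g => and_congr_right fun _ => ?_
  rw [mem_upperSites, hk.decBelow_iff]
  constructor
  · rintro ⟨hg, hn, ha, hz⟩
    exact ⟨⟨hn, ha, fun hgk => hp (hz.mono hgk)⟩, hz⟩
  · rintro ⟨⟨hn, ha, hgk⟩, hz⟩
    exact ⟨by omega, hn, ha, hz⟩

lemma not_prefix_append (hp : ¬ ZeroBefore σ k)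
    (h0 : 0 < (v : ℕ)) (hv : (v : ℕ) ≤ k) : ¬ ZeroBefore (appendValue σ v) v := by
  rw [zeroBefore_append h0 le_rfl]
  exact fun hz => hp (hz.mono hv)

lemma Unflagged.append {t : ℕ} (hσ : Unflagged σ k t) (h0 : 0 < (v : ℕ)) (hv : (v : ℕ) ≤ k) :
    Unflagged (appendValue σ v) v 0 := by
  have hT : upperSites (appendValue σ v) = ∅ := by
    refine Finset.eq_empty_of_forall_notMem fun h hh => ?_
    obtain ⟨g, -, hg, hz⟩ := (upperSites_append_of_not_prefix hσ.level hσ.not_prefix h0 hv).1 hh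
    exact hσ.not_sep g hg hz
  exact ⟨decLevel_append_of_decBelow (hσ.level.decBelow_iff.2 hv) h0, by rw [hT, Finset.card_empty],
    by simp [hT], not_prefix_append hσ.not_prefix h0 hv⟩

lemma Flagged.append {t : ℕ} (hσ : Flagged σ k t) (h0 : 0 < (v : ℕ)) (hv : (v : ℕ) ≤ k) :
    Flagged (appendValue σ v) v t := by
  have hd := hσ.level.decBelow_iff.2 hv
  have hT : upperSites (appendValue σ v) = (upperSites σ).map (addRightEmbedding 1) := by
    ext h
    rw [upperSites_append_of_not_prefix hσ.level hσ.not_prefix h0 hv, Finset.mem_map]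
    constructor
    · rintro ⟨g, rfl, hg, -⟩
      exact ⟨g, hg, rfl⟩
    · rintro ⟨g, hg, rfl⟩
      exact ⟨g, rfl, hg, hσ.sep g hg⟩
  exact ⟨decLevel_append_of_decBelow hd h0, by rw [hT, Finset.card_map, hσ.card],
    fun h hh => zeroBefore_of_mem_upperSites_append hd h0 hh,
    not_prefix_append hσ.not_prefix h0 hv⟩

/-- With the decreasing prefix, all upper sites survive and the site `k` becomes a new one. -/
lemma Prefixed.card_append {t : ℕ} (hσ : Prefixed σ k t) (h0 : 0 < (v : ℕ)) (hv : (v : ℕ) ≤ k) :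
    (upperSites (appendValue σ v)).card = t + 1 := by
  have hk := hσ.level
  have hT : upperSites (appendValue σ v) =
      (insert k (upperSites σ)).map (addRightEmbedding 1) := by
    ext h
    rw [mem_upperSites_append_of_decBelow (hk.decBelow_iff.2 hv) h0, Finset.mem_map]
    constructor
    · rintro ⟨g, rfl, hg, hn, ha, hz⟩
      refine ⟨g, ?_, rfl⟩
      rw [Finset.mem_insert, mem_upperSites, hk.decBelow_iff]
      rcases lt_trichotomy g k with hgk | hgk | hgk
      · exact absurd hz (not_zeroBefore_of_decBelow hk.1 (by omega) hgk hn)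
      · exact Or.inl hgk
      · exact Or.inr ⟨hn, ha, by omega⟩
    · rintro ⟨g, hg, rfl⟩
      refine ⟨g, rfl, ?_⟩
      rcases Finset.mem_insert.1 hg with rfl | hg
      · exact ⟨hv, hk.pos_and_lt.2, hk.1.activeSite, hσ.pre⟩
      · have hkg := hk.lt_of_mem hg
        obtain ⟨hn, ha, -⟩ := mem_upperSites.1 hg
        exact ⟨by omega, hn, ha, hσ.pre.mono hkg.le⟩
  rw [hT, Finset.card_map, Finset.card_insert_of_notMem, hσ.card]
  exact fun h => lt_irrefl k (hk.lt_of_mem h)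

lemma Prefixed.append_of_lt {t : ℕ} (hσ : Prefixed σ k t) (h0 : 0 < (v : ℕ)) (hv : (v : ℕ) < k) :
    Flagged (appendValue σ v) v (t + 1) := by
  have hd := hσ.level.decBelow_iff.2 hv.le
  refine ⟨decLevel_append_of_decBelow hd h0, hσ.card_append h0 hv.le,
    fun h hh => zeroBefore_of_mem_upperSites_append hd h0 hh, ?_⟩
  rw [zeroBefore_append h0 le_rfl]
  exact not_zeroBefore_of_decBelow hσ.level.1 h0 hv (hv.trans hσ.level.pos_and_lt.2)

lemma Prefixed.append_of_eq {t : ℕ} (hσ : Prefixed σ k t) (h0 : 0 < (v : ℕ)) (hv : (v : ℕ) = k) :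
    Prefixed (appendValue σ v) k (t + 1) := by
  have hd := hσ.level.decBelow_iff.2 hv.le
  refine ⟨?_, hσ.card_append h0 hv.le, ?_⟩
  · have := decLevel_append_of_decBelow hd h0
    rwa [hv] at this
  · rw [zeroBefore_append h0 hv.ge]
    exact hσ.pre

lemma upperSites_append_of_dec (hd : DecBelow σ n) (h0 : 0 < (v : ℕ)) :
    upperSites (appendValue σ v) = ∅ := by
  refine Finset.eq_empty_of_forall_notMem fun h hh => ?_
  obtain ⟨g, -, hg, hn, -, hz⟩ :=
    (mem_upperSites_append_of_decBelow (hd.mono (by omega)) h0).1 hh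
  exact not_zeroBefore_of_decBelow hd (by omega) hn hn hz

lemma unflagged_append_of_dec (hd : DecBelow σ n) (h0 : 0 < (v : ℕ)) (hv : (v : ℕ) < n) :
    Unflagged (appendValue σ v) v 0 := by
  have hT := upperSites_append_of_dec hd h0
  refine ⟨decLevel_append_of_decBelow (hd.mono hv.le) h0, by simp [hT], by simp [hT], ?_⟩
  rw [zeroBefore_append h0 le_rfl]
  exact not_zeroBefore_of_decBelow hd h0 hv hv

lemma prefixed_append_of_dec (hd : DecBelow σ n) (h0 : 0 < (v : ℕ)) (hv : (v : ℕ) = n) :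
    Prefixed (appendValue σ v) n 0 := by
  have hT := upperSites_append_of_dec hd h0
  refine ⟨by simpa [hv] using decLevel_append_of_decBelow (hd.mono hv.le) h0, by simp [hT], ?_⟩
  rw [zeroBefore_append h0 hv.ge]
  intro a x _ hx
  exact absurd (σ x).2 (by omega)

variable {D : ℕ → ℚ⟦X⟧} {U F S : ℕ → ℕ → ℚ⟦X⟧}

/-- From an unflagged permutation, the upper sites survive only when `0` is appended; the upper sites
and the top site all lead to the same state. -/
lemma class_descendants_unflagged
    (hU : ∀ k t, 0 < k → U k t =
      1 + X * (U (k + 1) t + ∑ i ∈ Finset.Icc 1 k, U i 0 + (t + 1) • U k 0)) (m : ℕ) :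
    ∀ {n : ℕ} (σ : Equiv.Perm (Fin n)) (k t : ℕ), Unflagged σ k t →
      (descendants ActiveSite m σ : ℚ) = coeff m (U k t) := by
  classical
  induction m with
  | zero =>
    intro n σ k t hσ
    rw [hU k t hσ.level.pos_and_lt.1, coeff_zero_one_add_X_mul]
    simp [descendants]
  | succ m ih =>
    intro n σ k t hσ
    obtain ⟨hk0, hkn⟩ := hσ.level.pos_and_lt
    rw [cast_descendants_succ, hU k t hk0, coeff_succ_one_add_X_mul,
      sum_sites (ActiveSite σ) (insert n (upperSites σ)) (k := k) (a := coeff m (U (k + 1) t))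
        (b := fun i => coeff m (U i 0)) (c := coeff m (U k 0))
        (fun v hv => hσ.level.activeSite_iff hv) hσ.level.mem_insert_upperSites hkn.le,
      card_insert_upperSites, hσ.card]
    · simp only [map_add, map_sum]
      rw [map_nsmul, nsmul_eq_mul]
    · exact ih _ _ _ (hσ.card ▸ unflagged_append_zero hσ.level)
    · exact fun v h0 hv => ih _ _ _ (hσ.append h0 hv)
    · exact fun v hv => ih _ _ _ (unflagged_append_of_mem hσ.level hσ.not_prefix hv)

/-- From a flagged permutation, the upper sites also survive when `v` with `1 ≤ v ≤ k` is appended,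
and they lose the flag when `0` is appended. -/
lemma class_descendants_flagged
    (hU : ∀ k t, 0 < k → U k t =
      1 + X * (U (k + 1) t + ∑ i ∈ Finset.Icc 1 k, U i 0 + (t + 1) • U k 0))
    (hF : ∀ k t, 0 < k → F k t =
      1 + X * (U (k + 1) t + ∑ i ∈ Finset.Icc 1 k, F i t + (t + 1) • U k 0)) (m : ℕ) :
    ∀ {n : ℕ} (σ : Equiv.Perm (Fin n)) (k t : ℕ), Flagged σ k t →
      (descendants ActiveSite m σ : ℚ) = coeff m (F k t) := by
  classical
  induction m with
  | zero =>
    intro n σ k t hσ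
    rw [hF k t hσ.level.pos_and_lt.1, coeff_zero_one_add_X_mul]
    simp [descendants]
  | succ m ih =>
    intro n σ k t hσ
    obtain ⟨hk0, hkn⟩ := hσ.level.pos_and_lt
    rw [cast_descendants_succ, hF k t hk0, coeff_succ_one_add_X_mul,
      sum_sites (ActiveSite σ) (insert n (upperSites σ)) (k := k) (a := coeff m (U (k + 1) t))
        (b := fun i => coeff m (F i t)) (c := coeff m (U k 0))
        (fun v hv => hσ.level.activeSite_iff hv) hσ.level.mem_insert_upperSites hkn.le,
      card_insert_upperSites, hσ.card]
    · simp only [map_add, map_sum]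
      rw [map_nsmul, nsmul_eq_mul]
    · exact class_descendants_unflagged hU m _ _ _ (hσ.card ▸ unflagged_append_zero hσ.level)
    · exact fun v h0 hv => ih _ _ _ (hσ.append h0 hv)
    · exact fun v hv => class_descendants_unflagged hU m _ _ _
        (unflagged_append_of_mem hσ.level hσ.not_prefix hv)

lemma sum_Icc_if_lt (k : ℕ) (hk : 0 < k) (f : ℕ → ℚ) (c : ℚ) :
    ∑ i ∈ Finset.Icc 1 k, (if i < k then f i else c) = ∑ i ∈ Finset.Ico 1 k, f i + c := by
  rw [← Finset.Ico_insert_right (show 1 ≤ k from hk), Finset.sum_insert (by simp),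
    add_comm]
  congr 1
  · exact Finset.sum_congr rfl fun i hi => if_pos (Finset.mem_Ico.1 hi).2
  · simp

/-- From a permutation that begins with its `k` smallest entries in decreasing order, appending `v`
with `1 ≤ v ≤ k` creates a new upper site, and the prefix is kept unless `v < k`. -/
lemma class_descendants_prefixed
    (hU : ∀ k t, 0 < k → U k t =
      1 + X * (U (k + 1) t + ∑ i ∈ Finset.Icc 1 k, U i 0 + (t + 1) • U k 0))
    (hF : ∀ k t, 0 < k → F k t =
      1 + X * (U (k + 1) t + ∑ i ∈ Finset.Icc 1 k, F i t + (t + 1) • U k 0))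
    (hS : ∀ k t, 0 < k → S k t = 1 + X * (U (k + 1) t +
      (∑ i ∈ Finset.Ico 1 k, F i (t + 1) + S k (t + 1)) + (t + 1) • S k 0)) (m : ℕ) :
    ∀ {n : ℕ} (σ : Equiv.Perm (Fin n)) (k t : ℕ), Prefixed σ k t →
      (descendants ActiveSite m σ : ℚ) = coeff m (S k t) := by
  classical
  induction m with
  | zero =>
    intro n σ k t hσ
    rw [hS k t hσ.level.pos_and_lt.1, coeff_zero_one_add_X_mul]
    simp [descendants]
  | succ m ih =>
    intro n σ k t hσ
    obtain ⟨hk0, hkn⟩ := hσ.level.pos_and_lt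
    rw [cast_descendants_succ, hS k t hk0, coeff_succ_one_add_X_mul,
      sum_sites (ActiveSite σ) (insert n (upperSites σ)) (k := k) (a := coeff m (U (k + 1) t))
        (b := fun i => if i < k then coeff m (F i (t + 1)) else coeff m (S k (t + 1)))
        (c := coeff m (S k 0))
        (fun v hv => hσ.level.activeSite_iff hv) hσ.level.mem_insert_upperSites hkn.le,
      card_insert_upperSites, hσ.card, sum_Icc_if_lt k hk0]
    · simp only [map_add, map_sum]
      rw [map_nsmul, nsmul_eq_mul]
    · exact class_descendants_unflagged hU m _ _ _ (hσ.card ▸ unflagged_append_zero hσ.level)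
    · intro v h0 hv
      rcases hv.lt_or_eq with hlt | heq
      · rw [if_pos hlt]
        exact class_descendants_flagged hU hF m _ _ _ (hσ.append_of_lt h0 hlt)
      · rw [if_neg (by omega)]
        exact ih _ _ _ (hσ.append_of_eq h0 heq)
    · exact fun v hv => ih _ _ _ (hσ.append_of_mem hv)

/-- Appending `n` to the decreasing permutation of length `n ≥ 1` produces a prefixed permutation. The
equation for `D 0` is separate, since then the only site is `0`. -/
lemma class_descendants_dec
    (hU : ∀ k t, 0 < k → U k t =
      1 + X * (U (k + 1) t + ∑ i ∈ Finset.Icc 1 k, U i 0 + (t + 1) • U k 0))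
    (hF : ∀ k t, 0 < k → F k t =
      1 + X * (U (k + 1) t + ∑ i ∈ Finset.Icc 1 k, F i t + (t + 1) • U k 0))
    (hS : ∀ k t, 0 < k → S k t = 1 + X * (U (k + 1) t +
      (∑ i ∈ Finset.Ico 1 k, F i (t + 1) + S k (t + 1)) + (t + 1) • S k 0))
    (hD0 : D 0 = 1 + X * D 1)
    (hD : ∀ k, 0 < k → D k = 1 + X * (D (k + 1) + (∑ i ∈ Finset.Ico 1 k, U i 0 + S k 0)))
    (m : ℕ) :
    ∀ {n : ℕ} (σ : Equiv.Perm (Fin n)), DecBelow σ n →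
      (descendants ActiveSite m σ : ℚ) = coeff m (D n) := by
  classical
  induction m with
  | zero =>
    intro n σ hd
    rcases Nat.eq_zero_or_pos n with rfl | hn
    · rw [hD0, coeff_zero_one_add_X_mul]
      simp [descendants]
    · rw [hD n hn, coeff_zero_one_add_X_mul]
      simp [descendants]
  | succ m ih =>
    intro n σ hd
    rw [cast_descendants_succ, sum_sites (ActiveSite σ) ∅ (k := n) (a := coeff m (D (n + 1)))
        (b := fun i => if i < n then coeff m (U i 0) else coeff m (S n 0)) (c := 0)]
    · rcases Nat.eq_zero_or_pos n with rfl | hn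
      · rw [hD0, coeff_succ_one_add_X_mul]
        simp
      · rw [hD n hn, coeff_succ_one_add_X_mul, sum_Icc_if_lt n hn]
        simp
    · intro v hv
      simp [(hd.mono hv).activeSite, hv]
    · simp
    · exact le_rfl
    · exact ih _ (decBelow_append_zero.2 hd)
    · intro v h0 hv
      rcases hv.lt_or_eq with hlt | heq
      · rw [if_pos hlt]
        exact class_descendants_unflagged hU m _ _ _ (unflagged_append_of_dec hd h0 hlt)
      · rw [if_neg (by omega)]
        exact class_descendants_prefixed hU hF hS m _ _ _ (prefixed_append_of_dec hd h0 heq)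
    · simp

end Class

/-! ### The series of the generating trees -/

/-- The root is the Catalan series at `X / (1 - X)`. -/
lemma exists_root : ∃ r : ℚ⟦X⟧, X * r ^ 2 = (1 - X) * (r - 1) := by
  have h1 : (1 - X : ℚ⟦X⟧) * (1 - X)⁻¹ = 1 := PowerSeries.mul_inv_cancel _ (by simp)
  have hs : HasSubst (X * (1 - X)⁻¹ : ℚ⟦X⟧) := HasSubst.of_constantCoeff_zero' (by simp)
  have hc := congrArg (fun f => substAlgHom (R := ℚ) hs (map (Nat.castRingHom ℚ) f))
    catalanSeries_sq_mul_X_add_one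
  simp only [map_add, map_mul, map_pow, map_one, map_X, substAlgHom_X] at hc
  exact ⟨substAlgHom (R := ℚ) hs (map (Nat.castRingHom ℚ) catalanSeries), by grind⟩

/-- The series `X`, the root `r` of `X r² = (1 - X)(r - 1)` and the inverses of the polynomials
`1 - X`, `2 - X`, `1 - 2X`, `1 - 3X + X²`, abstracted to elements of a ring. -/
structure TreeSeries (R : Type*) [CommRing R] where
  /-- The indeterminate. -/
  z : R
  /-- The root of the characteristic equation of the recurrence for `N`. -/
  r : R
  /-- The inverse of `1 - z`. -/
  u : R
  /-- The inverse of `2 - z`. -/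
  w : R
  /-- The inverse of `1 - 2z`. -/
  p : R
  /-- The inverse of `1 - 3z + z²`. -/
  q : R
  hr : z * r ^ 2 = (1 - z) * (r - 1)
  hu : (1 - z) * u = 1
  hw : (2 - z) * w = 1
  hp : (1 - 2 * z) * p = 1
  hq : (1 - 3 * z + z ^ 2) * q = 1

namespace TreeSeries

variable {R : Type*} [CommRing R] (P : TreeSeries R)

/-- The inverse of `1 - z r`, which is also the generating function of `Av(4123, 1243, 1423)`. -/
def J : R := (1 + P.r) * P.w

/-- The descendants of a permutation of level `k` without upper sites that does not begin with its
`k` smallest entries in decreasing order. -/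
def N (k : ℕ) : R := P.u * P.r ^ (k + 1)

/-- The contribution of each upper site to the descendants of an unflagged permutation. -/
def V (k : ℕ) : R := P.z * P.J * P.N k

/-- The contribution of each upper site to the descendants of a flagged permutation. -/
def G (k : ℕ) : R :=
  P.J * (P.u * P.w * (1 - P.z + P.z * P.r) * P.r ^ k + P.w * (P.z * P.r - 1) * P.u ^ k)

/-- The closed form of `z ∑_{0 < i < k} G i`, see `z_mul_sum_Ico_G`. -/
def g (k : ℕ) : R := (1 - P.z) * P.G k - P.z * P.J * P.N k

/-- The descendants of a permutation without upper sites that begins with its `k` smallest entries in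
decreasing order. With `B`, it solves the linear system of `A_eq` and `B_eq`, whose determinant is
`1 - 3z + z²`. -/
def A (k : ℕ) : R :=
  P.q * ((1 - P.z) * (P.r ^ k - P.z * P.N k + P.z * P.N (k + 1)) + P.z ^ 2 * P.V (k + 1) + P.g k)

/-- The contribution of each upper site to the descendants of a permutation that begins with its `k`
smallest entries in decreasing order. -/
def B (k : ℕ) : R :=
  P.q * ((1 - 2 * P.z) * P.z * P.V (k + 1) + (1 - P.z) * P.g k +
    P.z * (P.r ^ k - P.z * P.N k + P.z * P.N (k + 1)))

/-- The coefficient of `r ^ k` in `A k`. -/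
def a : R :=
  P.q * ((1 - P.z) * (1 - P.z * P.u * P.r + P.z * P.u * P.r ^ 2) +
    P.z ^ 2 * (P.z * P.J * P.u * P.r ^ 2) +
    ((1 - P.z) * (P.J * (P.u * P.w * (1 - P.z + P.z * P.r))) - P.z * P.J * P.u * P.r))

/-- The descendants of the decreasing permutation of length `k`, for `k > 0`. -/
def D (k : ℕ) : R :=
  P.J * (1 - P.z * P.u * P.r + P.z * P.a) * P.r ^ k -
    P.z * (1 - P.z) ^ 2 * P.q * P.w * P.p * P.u ^ k

lemma J_eq : P.J = 1 + P.z * P.r * P.J := by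
  have := P.hr; have := P.hw
  unfold J; grind

lemma z_mul_sum_N (k : ℕ) : P.z * ∑ i ∈ Finset.Icc 1 k, P.N i = P.r ^ k - 1 := by
  have := P.hr; have := P.hu
  induction k with
  | zero => simp
  | succ k ih =>
    rw [Finset.sum_Icc_succ_top (by omega), mul_add, ih, N]
    grind

lemma G_zero : P.G 0 = P.z * P.J * P.N 0 := by
  have := P.hr; have := P.hu; have := P.hw
  unfold G N; generalize P.J = j; grind

lemma G_succ (k : ℕ) : (1 - P.z) * P.G (k + 1) = P.G k + P.z * P.J * (P.N (k + 1) - P.N k) := by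
  have := P.hr; have := P.hu; have := P.hw
  unfold G N; generalize P.J = j
  simp only [pow_succ]
  generalize P.r ^ k = x, P.u ^ k = y; grind

lemma z_mul_sum_G (k : ℕ) : P.z * ∑ i ∈ Finset.Icc 1 k, P.G i = P.G k - P.z * P.J * P.N k := by
  induction k with
  | zero => simp [G_zero]
  | succ k ih =>
    rw [Finset.sum_Icc_succ_top (by omega), mul_add, ih]
    linear_combination -P.G_succ k

lemma z_mul_sum_Ico_N {k : ℕ} (hk : 0 < k) :
    P.z * ∑ i ∈ Finset.Ico 1 k, P.N i = P.r ^ k - 1 - P.z * P.N k := by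
  rw [← P.z_mul_sum_N, ← Finset.Ico_insert_right (show 1 ≤ k from hk), Finset.sum_insert (by simp)]
  ring

lemma z_mul_sum_Ico_G {k : ℕ} (hk : 0 < k) :
    P.z * ∑ i ∈ Finset.Ico 1 k, P.G i = P.g k := by
  have := P.z_mul_sum_G k
  rw [← Finset.Ico_insert_right (show 1 ≤ k from hk), Finset.sum_insert (by simp)] at this
  rw [g]
  linear_combination this

lemma N_eq (k : ℕ) :
    P.N k = 1 + P.z * (P.N (k + 1) + ∑ i ∈ Finset.Icc 1 k, P.N i + P.N k) := by
  have := P.hr; have := P.hu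
  have := P.z_mul_sum_N k
  unfold N at *
  simp only [pow_succ] at *
  grind

lemma V_eq (k : ℕ) : P.V k = P.z * (P.V (k + 1) + P.N k) := by
  have h := P.J_eq
  unfold V N
  linear_combination P.z * P.u * P.r ^ (k + 1) * h

lemma G_eq (k : ℕ) : P.G k = P.z * (P.V (k + 1) + ∑ i ∈ Finset.Icc 1 k, P.G i + P.N k) := by
  have h := P.J_eq
  have := P.z_mul_sum_G k
  unfold V N at *
  linear_combination -this + P.z * P.u * P.r ^ (k + 1) * h

lemma B_eq {k : ℕ} (hk : 0 < k) :
    P.B k = P.z * (P.V (k + 1) + (∑ i ∈ Finset.Ico 1 k, P.G i + P.B k) + P.A k) := by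
  have := P.hq
  have := P.z_mul_sum_Ico_G hk
  unfold A B
  grind

lemma A_eq {k : ℕ} (hk : 0 < k) :
    P.A k = 1 + P.z * (P.N (k + 1) + (∑ i ∈ Finset.Ico 1 k, (P.N i + P.G i) + (P.A k + P.B k)) +
      P.A k) := by
  have := P.hq
  have := P.z_mul_sum_Ico_G hk
  have := P.z_mul_sum_Ico_N hk
  rw [Finset.sum_add_distrib]
  unfold A B
  grind

/-- The decomposition of `A k` into multiples of `r ^ k` and `u ^ k`, multiplied by `u` so that the
factor `1 - z` of the second coefficient disappears. -/
lemma A_split (k : ℕ) : P.u * P.A k = P.u * P.a * P.r ^ k - P.q * P.w * P.u ^ k := by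
  have := P.hu; have := P.J_eq
  unfold A a g V G N
  simp only [pow_succ]
  generalize P.r ^ k = x, P.u ^ k = y
  generalize P.J = j at *
  grind

lemma D_eq {k : ℕ} (hk : 0 < k) :
    P.D k = 1 + P.z * (P.D (k + 1) + (∑ i ∈ Finset.Ico 1 k, P.N i + P.A k)) := by
  have := P.hu; have := P.J_eq; have := P.A_split k
  have := P.z_mul_sum_Ico_N hk; have := P.hp
  unfold D N at *
  simp only [pow_succ] at *
  generalize P.J = j at *
  generalize P.a = a at *
  grind

lemma total_eq :
    (2 * P.z * (2 - P.z) ^ 2 * (1 - 2 * P.z) * (1 - 3 * P.z + P.z ^ 2)) * (1 + P.z * P.D 1) =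
      2 - 8 * P.z + 2 * P.z ^ 2 + 17 * P.z ^ 3 - 15 * P.z ^ 4 + 4 * P.z ^ 5
        - (2 - 10 * P.z + 16 * P.z ^ 2 - 9 * P.z ^ 3 + 2 * P.z ^ 4) *
          (1 - P.z - 2 * P.z * P.r) := by
  have := P.hu; have := P.hp; have := P.hq; have := P.hw; have := P.hr
  unfold D a J
  grind

lemma J_mul : (2 * (2 * P.z - P.z ^ 2)) * P.J = 1 + P.z - (1 - P.z - 2 * P.z * P.r) := by
  have := P.hw
  unfold J; grind

/-- The square root of the discriminant of the equation for `r`. -/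
lemma sqrt_sq : (1 - P.z - 2 * P.z * P.r) ^ 2 = 1 - 6 * P.z + 5 * P.z ^ 2 := by
  have := P.hr
  grind

end TreeSeries

/-! ### The generating functions -/

lemma constantCoeff_two : constantCoeff (2 : ℚ⟦X⟧) = 2 := map_ofNat _ 2

lemma exists_treeSeries : ∃ P : TreeSeries ℚ⟦X⟧, P.z = X := by
  obtain ⟨r, hr⟩ := exists_root
  exact ⟨⟨X, r, (1 - X)⁻¹, (2 - X)⁻¹, (1 - 2 * X)⁻¹, (1 - 3 * X + X ^ 2)⁻¹, hr,
    PowerSeries.mul_inv_cancel _ (by simp),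
    PowerSeries.mul_inv_cancel _ (by simp [constantCoeff_two]),
    PowerSeries.mul_inv_cancel _ (by simp),
    PowerSeries.mul_inv_cancel _ (by simp)⟩, rfl⟩

section GenFun

variable (P : TreeSeries ℚ⟦X⟧)

lemma one_mem_classAv : (1 : Equiv.Perm (Fin 0)) ∈ classAv 0 :=
  ⟨fun ⟨f, _⟩ => (f 0).elim0, fun ⟨f, _⟩ => (f 0).elim0⟩

lemma one_mem_subclassAv : (1 : Equiv.Perm (Fin 0)) ∈ subclassAv 0 :=
  ⟨one_mem_classAv, fun ⟨f, _⟩ => (f 0).elim0⟩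

lemma genFun_subclassAv (hz : P.z = X) : genFun subclassAv = P.J := by
  ext m
  rw [coeff_genFun (ok := SubclassSite) one_mem_subclassAv
    (fun n σ v => append_mem_subclassAv σ v) m,
    subclass_descendants_dec (N := P.N) (D := fun k => P.J * P.r ^ k)
      (fun k _ => by rw [← hz]; exact P.N_eq k) _ m 1 (fun a => a.elim0), pow_zero, mul_one]
  intro k
  have h1 := P.z_mul_sum_N k
  have h2 := P.J_eq
  rw [← hz]
  simp only [pow_succ]
  linear_combination P.r ^ k * h2 - h1

lemma genFun_classAv (hz : P.z = X) : genFun classAv = 1 + P.z * P.D 1 := by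
  ext m
  rw [coeff_genFun (ok := ActiveSite) one_mem_classAv (fun n σ v => append_mem_classAv σ v) m,
    class_descendants_dec
      (U := fun k t => P.N k + t * P.V k) (F := fun k t => P.N k + t * P.G k)
      (S := fun k t => P.A k + t * P.B k)
      (D := fun k => if k = 0 then 1 + P.z * P.D 1 else P.D k)
      ?_ ?_ ?_ ?_ ?_ m 1 (fun a => a.elim0)]
  · simp
  · intro k t hk
    simp only [nsmul_eq_mul, Nat.cast_zero, zero_mul, add_zero, Nat.cast_add, Nat.cast_one]
    rw [← hz]
    linear_combination P.N_eq k + (t : ℚ⟦X⟧) * P.V_eq k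
  · intro k t hk
    simp only [nsmul_eq_mul, Nat.cast_zero, zero_mul, add_zero, Nat.cast_add, Nat.cast_one,
      Finset.sum_add_distrib, ← Finset.mul_sum]
    rw [← hz]
    linear_combination P.N_eq k + (t : ℚ⟦X⟧) * P.G_eq k
  · intro k t hk
    have hA := P.A_eq hk
    simp only [nsmul_eq_mul, Nat.cast_zero, zero_mul, add_zero, Nat.cast_add, Nat.cast_one,
      Finset.sum_add_distrib, ← Finset.mul_sum] at hA ⊢
    rw [← hz]
    linear_combination hA + (t : ℚ⟦X⟧) * P.B_eq hk
  · simp [hz]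
  · intro k hk
    simp only [hk.ne', if_false, k.succ_ne_zero, Nat.cast_zero, zero_mul, add_zero]
    rw [← hz]
    exact P.D_eq hk

end GenFun

lemma genFun_classAv_eq_add : genFun classAv = genFun subclassAv + genFun containing1423 := by
  ext n
  simp only [genFun, coeff_mk, map_add]
  rw [← Nat.cast_add, ← Set.ncard_union_eq]
  · congr 2
    ext σ
    by_cases h : Contains σ ![1, 4, 2, 3] <;> simp [subclassAv, containing1423, Avoids, h]
  · rw [Set.disjoint_left]
    exact fun σ h1 h2 => h1.2 h2.2

lemma coe_eq_div {f g h : ℚ⟦X⟧} (hg : g ≠ 0) (e : g * f = h) :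
    (f : ℚ⸨X⸩) = (h : ℚ⸨X⸩) / (g : ℚ⸨X⸩) := by
  have hg' : (g : ℚ⸨X⸩) ≠ 0 := by
    intro h0
    exact hg (HahnSeries.ofPowerSeries_injective (Γ := ℤ) (h0.trans (map_zero _).symm))
  rw [eq_div_iff hg', ← e, mul_comm]
  exact (map_mul (HahnSeries.ofPowerSeries ℤ ℚ) g f).symm

theorem theorem2 :
    ∃ S : ℚ⟦X⟧, PowerSeries.constantCoeff S = 1 ∧
      S ^ 2 = 1 - 6 * (PowerSeries.X : ℚ⟦X⟧) + 5 * (PowerSeries.X : ℚ⟦X⟧) ^ 2 ∧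
      let z : ℚ⸨X⸩ := ((PowerSeries.X : ℚ⟦X⟧) : ℚ⸨X⸩)
      let s : ℚ⸨X⸩ := (S : ℚ⸨X⸩)
      ((genFun classAv : ℚ⟦X⟧) : ℚ⸨X⸩) =
        (2 - 8 * z + 2 * z ^ 2 + 17 * z ^ 3 - 15 * z ^ 4 + 4 * z ^ 5
            - (2 - 10 * z + 16 * z ^ 2 - 9 * z ^ 3 + 2 * z ^ 4) * s)
          / (2 * z * (2 - z) ^ 2 * (1 - 2 * z) * (1 - 3 * z + z ^ 2)) ∧
      genFun classAv = genFun subclassAv + genFun containing1423 ∧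
      ((genFun subclassAv : ℚ⟦X⟧) : ℚ⸨X⸩) = (1 + z - s) / (2 * (2 * z - z ^ 2)) ∧
      ((genFun containing1423 : ℚ⟦X⟧) : ℚ⸨X⸩) =
        (1 - z) * (1 - 5 * z + 4 * z ^ 2 - 2 * z ^ 3 - (1 - 2 * z) * s)
          / (2 * (1 - 2 * z) * (1 - 3 * z + z ^ 2) * (2 - z) ^ 2) := by
  obtain ⟨P, hz⟩ := exists_treeSeries
  have hX : (X : ℚ⟦X⟧) ≠ 0 := X_ne_zero
  have h1 : (1 - 2 * X : ℚ⟦X⟧) ≠ 0 := fun h => by simpa using congrArg constantCoeff h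
  have h2 : (2 - X : ℚ⟦X⟧) ≠ 0 := fun h => by
    simpa [constantCoeff_two] using congrArg constantCoeff h
  have h3 : (1 - 3 * X + X ^ 2 : ℚ⟦X⟧) ≠ 0 := fun h => by simpa using congrArg constantCoeff h
  have h4 : (2 : ℚ⟦X⟧) ≠ 0 := fun h => by
    simpa [constantCoeff_two] using congrArg constantCoeff h
  have h5 : (2 * X - X ^ 2 : ℚ⟦X⟧) ≠ 0 := by
    rw [show (2 * X - X ^ 2 : ℚ⟦X⟧) = X * (2 - X) by ring]
    exact mul_ne_zero hX h2
  have hJ := P.J_mul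
  have hT := P.total_eq
  have hsum := genFun_classAv_eq_add
  rw [← genFun_classAv P hz, hz] at hT
  rw [← genFun_subclassAv P hz, hz] at hJ
  refine ⟨1 - X - 2 * X * P.r, by simp, by rw [← hz]; exact P.sqrt_sq, ?_, hsum, ?_, ?_⟩
  · rw [coe_eq_div (by positivity) hT]
    simp only [map_sub, map_add, map_mul, map_pow, map_one, map_ofNat]
  · rw [coe_eq_div (by positivity) hJ]
    simp only [map_sub, map_add, map_mul, map_pow, map_one, map_ofNat]
  · have hK : (2 * (1 - 2 * X) * (1 - 3 * X + X ^ 2) * (2 - X) ^ 2) * genFun containing1423 =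
        (1 - X) * (1 - 5 * X + 4 * X ^ 2 - 2 * X ^ 3 -
          (1 - 2 * X) * (1 - X - 2 * X * P.r)) := by
      refine mul_left_cancel₀ hX ?_
      rw [hsum] at hT
      linear_combination hT - (1 - 2 * X) * (1 - 3 * X + X ^ 2) * (2 - X) * hJ
    rw [coe_eq_div (by positivity) hK]
    simp only [map_sub, map_add, map_mul, map_pow, map_one, map_ofNat]
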